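/- Let $d\ge 1$, let $\Lambda\subset\mathbb R^d$ be a full-rank lattice of covolume $1$, and let $s\mapsto\boldsymbol\tau(s)=(\tau_1(s),\dots,\tau_d(s))\in\mathbb R^d$, $s>0$, be an arbitrary path with $\tau_1(s)+\dots+\tau_d(s)=0$ for all $s>0$. For $s>0$ put $$\mathcal B(s)=D_{\boldsymbol\tau(s)}[-1,1]^d,\qquad D_{\boldsymbol\tau}=\operatorname{diag}(e^{\tau_1},\dots,e^{\tau_d}),$$ and for $1\le p\le d$ let $\lambda_p(\mathcal B(s))$ be the $p$-th successive minimum of $\mathcal B(s)$ with respect to $\Lambda$, i.e. the infimum of those $r>0$ for which $r\mathcal B(s)$ contains $p$ linearly independent points of $\Lambda$. Define $$\psi_p(s)=\frac{\ln\lambda_p(\mathcal B(s))}{s},\qquad \underline\psi_p=\liminf_{s\to+\infty}\psi_p(s),\qquad \overline\psi_p=\limsup_{s\to+\infty}\psi_p(s),$$ $$\underline\Psi_p=\liminf_{s\to+\infty}\sum_{i=1}^p\psi_i(s),\qquad \overline\Psi_p=\limsup_{s\to+\infty}\sum_{i=1}^p\psi_i(s),$$ all limits being taken in the extended real line $[-\infty,+\infty]$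 (for $d=1$, $\underline\Psi_0=\overline\Psi_0=0$ by the empty-sum convention). Then $$\underline\Psi_{d-1}=-\overline\psi_d\qquad\text{and}\qquad\overline\Psi_{d-1}=-\underline\psi_d .$$ -/

import Mathlib

open scoped Pointwise Matrix

noncomputable section

namespace SchmidtExponents

/-- The unit ball of the sup-norm in `ℝ^d`, i.e. the cube with vertices `(±1, …, ±1)`. -/
def cube (d : ℕ) : Set (Fin d → ℝ) :=
  {x | ∀ i, |x i| ≤ 1}

/-- The diagonal matrix `D_τ` with `e^{τ_1}, …, e^{τ_d}` on the main diagonal. -/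
def diagExp {d : ℕ} (τ : Fin d → ℝ) : Matrix (Fin d) (Fin d) ℝ :=
  Matrix.diagonal fun i => Real.exp (τ i)

/-- The parallelepiped `D_τ B_∞^d`. -/
def box {d : ℕ} (τ : Fin d → ℝ) : Set (Fin d → ℝ) :=
  (fun x => diagExp τ *ᵥ x) '' cube d

/-- The `p`-th successive minimum of `M` with respect to `L`: the infimum of the positive `r`
such that `r M` contains `p` linearly independent points of `L`. -/
def successiveMin {d : ℕ} (L : Submodule ℤ (Fin d → ℝ)) (M : Set (Fin d → ℝ)) (p : ℕ) : ℝ :=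
  sInf {r : ℝ | 0 < r ∧ ∃ v : Fin p → (Fin d → ℝ),
    (∀ i, v i ∈ L ∧ v i ∈ r • M) ∧ LinearIndependent ℝ v}

/-- The function `ψ_p(L, τ, s) = ln (λ_p (D_{τ(s)} B_∞^d)) / s`, for `1 ≤ p ≤ d` and `s > 0`. -/
def psi {d : ℕ} (L : Submodule ℤ (Fin d → ℝ)) (τ : ℝ → Fin d → ℝ) (p : ℕ) (s : ℝ) : ℝ :=
  Real.log (successiveMin L (box (τ s)) p) / s

/-- The `p`-th lower Schmidt exponent of the first type, an extended real number. -/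
def lowerPsi₁ {d : ℕ} (L : Submodule ℤ (Fin d → ℝ)) (τ : ℝ → Fin d → ℝ) (p : ℕ) : EReal :=
  Filter.liminf (fun s : ℝ => ((psi L τ p s : ℝ) : EReal)) Filter.atTop

/-- The `p`-th upper Schmidt exponent of the first type, an extended real number. -/
def upperPsi₁ {d : ℕ} (L : Submodule ℤ (Fin d → ℝ)) (τ : ℝ → Fin d → ℝ) (p : ℕ) : EReal :=
  Filter.limsup (fun s : ℝ => ((psi L τ p s : ℝ) : EReal)) Filter.atTop

/-- The `p`-th lower Schmidt exponent of the second type, an extended real number. -/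
def lowerPsi₂ {d : ℕ} (L : Submodule ℤ (Fin d → ℝ)) (τ : ℝ → Fin d → ℝ) (p : ℕ) : EReal :=
  Filter.liminf (fun s : ℝ => ((∑ i ∈ Finset.Icc 1 p, psi L τ i s : ℝ) : EReal)) Filter.atTop

/-- The `p`-th upper Schmidt exponent of the second type, an extended real number. -/
def upperPsi₂ {d : ℕ} (L : Submodule ℤ (Fin d → ℝ)) (τ : ℝ → Fin d → ℝ) (p : ℕ) : EReal :=
  Filter.limsup (fun s : ℝ => ((∑ i ∈ Finset.Icc 1 p, psi L τ i s : ℝ) : EReal)) Filter.atTop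

end SchmidtExponents

end

noncomputable section

namespace SchmidtExponents

open Module Submodule Filter Topology

/-! Minkowski's second theorem gives λ_1⋯λ_d between two positive constants depending only on d,
since every box has the same volume. Hence ψ_1+⋯+ψ_d is O(1/s), so ψ_1+⋯+ψ_{d-1} = -ψ_d + o(1), and
negation exchanges liminf and limsup. The minima are realised by a greedy family.
`one_le_factorial_mul_prod` bounds their product below by a determinant; `prod_le_pow` bounds it
above by Minkowski's first theorem applied to a box in QR coordinates. -/

/-- A linearly independent family in `L` that is chosen greedily with respect to `N`: each member
minimises `N` among the points of `L` outside the span of its predecessors. -/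
structure IsGreedy {V : Type*} [AddCommGroup V] [Module ℝ V] (L : Submodule ℤ V) (N : V → ℝ)
    {n : ℕ} (v : Fin n → V) : Prop where
  linearIndependent : LinearIndependent ℝ v
  mem : ∀ i, v i ∈ L
  le : ∀ i, ∀ y ∈ L, y ∉ span ℝ (v '' Set.Iio i) → N (v i) ≤ N y

/-! ### Greedy families and successive minima. -/

section Greedy

variable {V : Type*} [AddCommGroup V] [Module ℝ V] {L : Submodule ℤ V} {N : V → ℝ}

lemma exists_minimal_notMem (hspan : span ℝ (L : Set V) = ⊤)
    (hfin : ∀ R : ℝ, {x | x ∈ L ∧ N x ≤ R}.Finite) {W : Submodule ℝ V} (hW : W ≠ ⊤) :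
    ∃ x ∈ L, x ∉ W ∧ ∀ y ∈ L, y ∉ W → N x ≤ N y := by
  obtain ⟨x₀, hx₀, hx₀W⟩ : ∃ x ∈ L, x ∉ W := by
    by_contra! h
    exact hW (top_le_iff.1 (hspan ▸ span_le.2 h))
  have hfin' : {x | x ∈ L ∧ N x ≤ N x₀ ∧ x ∉ W}.Finite :=
    (hfin (N x₀)).subset fun x hx => ⟨hx.1, hx.2.1⟩
  obtain ⟨x, hx, hmin⟩ := Set.exists_min_image _ N hfin' ⟨x₀, hx₀, le_rfl, hx₀W⟩
  refine ⟨x, hx.1, hx.2.2, fun y hy hyW => ?_⟩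
  rcases le_total (N y) (N x₀) with h | h
  · exact hmin y ⟨hy, h, hyW⟩
  · exact hx.2.1.trans h

lemma exists_isGreedy [FiniteDimensional ℝ V] (hspan : span ℝ (L : Set V) = ⊤)
    (hfin : ∀ R : ℝ, {x | x ∈ L ∧ N x ≤ R}.Finite) {n : ℕ} (hn : n ≤ finrank ℝ V) :
    ∃ v : Fin n → V, IsGreedy L N v := by
  induction n with
  | zero => exact ⟨Fin.elim0, linearIndependent_empty_type, fun i => i.elim0, fun i => i.elim0⟩
  | succ n ih =>
    obtain ⟨v, hv⟩ := ih (by omega)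
    have hW : span ℝ (Set.range v) ≠ ⊤ := by
      intro h
      have := finrank_span_eq_card hv.linearIndependent
      rw [h, finrank_top, Fintype.card_fin] at this
      omega
    obtain ⟨x, hxL, hxW, hmin⟩ := exists_minimal_notMem hspan hfin hW
    have himage : ∀ i : Fin n, (Fin.snoc v x : Fin (n + 1) → V) '' Set.Iio i.castSucc =
        v '' Set.Iio i := by
      intro i
      ext y
      constructor
      · rintro ⟨j, hj, rfl⟩
        induction j using Fin.lastCases with
        | last => exact absurd hj (by simp [Fin.le_last])
        | cast j => exact ⟨j, by simpa using hj, by simp⟩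
      · rintro ⟨j, hj, rfl⟩
        exact ⟨j.castSucc, by simpa using hj, by simp⟩
    have himage_last : (Fin.snoc v x : Fin (n + 1) → V) '' Set.Iio (Fin.last n) =
        Set.range v := by
      ext y
      constructor
      · rintro ⟨j, hj, rfl⟩
        induction j using Fin.lastCases with
        | last => exact absurd hj (by simp)
        | cast j => exact ⟨j, by simp⟩
      · rintro ⟨j, rfl⟩
        exact ⟨j.castSucc, Fin.castSucc_lt_last j, by simp⟩
    refine ⟨Fin.snoc v x, linearIndependent_finSnoc.2 ⟨hv.linearIndependent, hxW⟩, ?_, ?_⟩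
    · intro i
      induction i using Fin.lastCases with
      | last => simpa using hxL
      | cast i => simpa using hv.mem i
    · intro i
      induction i using Fin.lastCases with
      | last => simpa [himage_last] using hmin
      | cast i => simpa [himage] using hv.le i

variable {n : ℕ} {v : Fin n → V}

lemma IsGreedy.notMem_span_image (hv : IsGreedy L N v) (i : Fin n) :
    v i ∉ span ℝ (v '' Set.Iio i) :=
  hv.linearIndependent.notMem_span_image (by simp)

lemma IsGreedy.monotone (hv : IsGreedy L N v) : Monotone (N ∘ v) := by
  intro i j hij
  refine hv.le i _ (hv.mem j) fun h => hv.notMem_span_image j ?_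
  exact span_mono (Set.image_mono (Set.Iio_subset_Iio hij)) h

/-- A nonzero lattice point involves a last member of a greedy basis, and is at least as long
as that member. -/
lemma IsGreedy.exists_mem_span_image_Iic (hv : IsGreedy L N v) (hn : span ℝ (Set.range v) = ⊤)
    {x : V} (hx : x ∈ L) (hx0 : x ≠ 0) :
    ∃ k, x ∈ span ℝ (v '' Set.Iic k) ∧ N (v k) ≤ N x := by
  have key : ∀ m ≤ n, x ∈ span ℝ (v '' {i | (i : ℕ) < m}) →
      ∃ k, x ∈ span ℝ (v '' Set.Iic k) ∧ N (v k) ≤ N x := by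
    intro m
    induction m with
    | zero => intro _ h; simp [hx0] at h
    | succ m ih =>
      intro hm h
      by_cases h' : x ∈ span ℝ (v '' {i | (i : ℕ) < m})
      · exact ih (by omega) h'
      · refine ⟨⟨m, hm⟩, ?_, hv.le _ x hx h'⟩
        convert h using 4
        ext i
        simp [Fin.le_def]
  refine key n le_rfl ?_
  have : {i : Fin n | (i : ℕ) < n} = Set.univ := by ext; simp
  rw [this, Set.image_univ, hn]
  trivial

/-- The members of a greedy family realise the successive minima. -/
lemma IsGreedy.isLeast (hv : IsGreedy L N v) (hpos : ∀ x, x ≠ 0 → 0 < N x) (k : Fin n) :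
    IsLeast {r : ℝ | 0 < r ∧ ∃ u : Fin (k + 1) → V,
      (∀ i, u i ∈ L ∧ N (u i) ≤ r) ∧ LinearIndependent ℝ u} (N (v k)) := by
  constructor
  · refine ⟨hpos _ (hv.linearIndependent.ne_zero k), v ∘ Fin.castLE k.2, fun i => ⟨hv.mem _, ?_⟩,
      hv.linearIndependent.comp _ (Fin.castLE_injective _)⟩
    exact hv.monotone (Fin.le_def.2 (Nat.lt_succ_iff.1 i.2))
  · rintro r ⟨-, u, hu, hli⟩
    by_contra! hlt
    have hsub : Set.range u ⊆ span ℝ (v '' Set.Iio k) := by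
      rintro _ ⟨i, rfl⟩
      by_contra h
      exact absurd (hv.le k _ (hu i).1 h) (not_le.2 ((hu i).2.trans_lt hlt))
    have h1 := finrank_span_eq_card hli
    have : FiniteDimensional ℝ (span ℝ (v '' Set.Iio k)) :=
      FiniteDimensional.span_of_finite ℝ (Set.toFinite _)
    have h2 := Submodule.finrank_mono (span_le.2 hsub)
    have h3 : finrank ℝ (span ℝ (v '' Set.Iio k)) ≤ k := by
      classical
      have := finrank_span_finset_le_card (R := ℝ) ((Finset.Iio k).image v)
      rw [Finset.coe_image, Finset.coe_Iio] at this
      exact this.trans (Finset.card_image_le.trans (by simp))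
    rw [h1, Fintype.card_fin] at h2
    omega

end Greedy

/-! ### Matrix estimates. -/

/-- The `Q` of a `QR` decomposition of the matrix with columns `w i`. -/
lemma exists_orthogonal_triangular {d : ℕ} (w : Fin d → Fin d → ℝ) :
    ∃ Q : Matrix (Fin d) (Fin d) ℝ, Q ∈ Matrix.orthogonalGroup (Fin d) ℝ ∧
      ∀ i j, i < j → (Q *ᵥ w i) j = 0 := by
  let f : Fin d → EuclideanSpace ℝ (Fin d) := fun i => WithLp.toLp 2 (w i)
  let b := InnerProductSpace.gramSchmidtOrthonormalBasis (𝕜 := ℝ) (by simp) f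
  refine ⟨Matrix.of fun j i => b j i, ?_, fun i j hij => ?_⟩
  · rw [Matrix.mem_orthogonalGroup_iff]
    ext i j
    have := orthonormal_iff_ite.1 b.orthonormal j i
    simpa [PiLp.inner_apply, Matrix.mul_apply, Matrix.one_apply, eq_comm] using this
  · have := InnerProductSpace.gramSchmidtOrthonormalBasis_inv_triangular (𝕜 := ℝ) (by simp) f hij
    simpa [PiLp.inner_apply, Matrix.mulVec, dotProduct, mul_comm] using this

/-- Leibniz expansion: `d!` products, each at most `∏ i, m i`. Any constant depending only on `d`
suffices here. -/
lemma abs_det_le_of_norm_row_le {d : ℕ} (A : Matrix (Fin d) (Fin d) ℝ) (m : Fin d → ℝ)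
    (h : ∀ i, ‖A i‖ ≤ m i) : |A.det| ≤ d.factorial * ∏ i, m i := by
  rw [← Matrix.det_transpose, Matrix.det_apply']
  refine (Finset.abs_sum_le_sum_abs _ _).trans ?_
  have : ∀ σ ∈ (Finset.univ : Finset (Equiv.Perm (Fin d))),
      |((Equiv.Perm.sign σ : ℤ) : ℝ) * ∏ i, Aᵀ (σ i) i| ≤ ∏ i, m i := by
    intro σ _
    have hsign : |((Equiv.Perm.sign σ : ℤ) : ℝ)| = 1 := by
      rcases Int.units_eq_one_or (Equiv.Perm.sign σ) with h | h <;> simp [h]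
    rw [abs_mul, hsign, one_mul, Finset.abs_prod]
    exact Finset.prod_le_prod (fun _ _ => abs_nonneg _)
      fun i _ => (norm_le_pi_norm (A i) (σ i)).trans (h i)
  refine (Finset.sum_le_card_nsmul _ _ _ this).trans ?_
  simp [Fintype.card_perm]

/-! ### Bounds for the product of the minima. -/

section Lattice

variable {d : ℕ} (L : Submodule ℤ (Fin d → ℝ)) [DiscreteTopology L] [IsZLattice ℝ L]

/-- The coordinates in a lattice basis form an integer matrix with nonzero determinant, so its
absolute value is at least 1. -/
lemma covolume_le_abs_det {v : Fin d → Fin d → ℝ} (hv : LinearIndependent ℝ v)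
    (hL : ∀ i, v i ∈ L) :
    ZLattice.covolume L MeasureTheory.volume ≤ |(Matrix.of v).det| := by
  let b : Basis (Fin d) ℤ L := IsZLattice.basis L
  rw [ZLattice.covolume_eq_det L b]
  let P : Matrix (Fin d) (Fin d) ℤ := Matrix.of fun i j => b.repr ⟨v i, hL i⟩ j
  have hP : Matrix.of v = P.map (Int.castRingHom ℝ) * Matrix.of ((↑) ∘ b) := by
    ext i j
    have h1 := congrArg (fun y : L => (y : Fin d → ℝ) j) (b.sum_repr ⟨v i, hL i⟩)
    simp only [Submodule.coe_sum, Finset.sum_apply, Submodule.coe_smul,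
      zsmul_eq_mul] at h1
    simp [Matrix.mul_apply, P, ← h1]
  have hdet : (Matrix.of v).det ≠ 0 := by
    have := (Matrix.linearIndependent_rows_iff_isUnit (A := Matrix.of v)).1 hv
    exact ((Matrix.isUnit_iff_isUnit_det _).1 this).ne_zero
  rw [hP, Matrix.det_mul, ← RingHom.mapMatrix_apply, ← RingHom.map_det] at hdet ⊢
  have hP0 : P.det ≠ 0 := by rintro h; simp [h] at hdet
  have h1 : (1 : ℝ) ≤ |((P.det : ℤ) : ℝ)| := by exact_mod_cast Int.one_le_abs hP0
  rw [abs_mul]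
  exact le_mul_of_one_le_left (abs_nonneg _) h1

/-- The lower bound in Minkowski's second theorem. -/
lemma one_le_factorial_mul_prod (hcov : ZLattice.covolume L MeasureTheory.volume = 1)
    {M : Matrix (Fin d) (Fin d) ℝ} (hM : |M.det| = 1) {v : Fin d → Fin d → ℝ}
    (hv : LinearIndependent ℝ v) (hL : ∀ i, v i ∈ L) :
    1 ≤ d.factorial * ∏ i, ‖M *ᵥ v i‖ := by
  have h1 : (Matrix.of fun i => M *ᵥ v i) = Matrix.of v * Mᵀ := by
    ext i j
    simp [Matrix.mul_apply, Matrix.mulVec, dotProduct, mul_comm]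
  calc (1 : ℝ) ≤ |(Matrix.of v).det| := hcov ▸ covolume_le_abs_det L hv hL
    _ = |(Matrix.of fun i => M *ᵥ v i).det| := by
      rw [h1, Matrix.det_mul, abs_mul, Matrix.det_transpose, hM, mul_one]
    _ ≤ _ := abs_det_le_of_norm_row_le _ _ fun i => le_rfl

/-- The upper bound in Minkowski's second theorem, with a non-optimal constant. -/
lemma prod_le_pow (hd : 1 ≤ d) (hcov : ZLattice.covolume L MeasureTheory.volume = 1)
    {M : Matrix (Fin d) (Fin d) ℝ} (hM : |M.det| = 1) {v : Fin d → Fin d → ℝ}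
    (hv : IsGreedy L (fun x => ‖M *ᵥ x‖) v) :
    ∏ i, ‖M *ᵥ v i‖ ≤ (d : ℝ) ^ d := by
  set m : Fin d → ℝ := fun i => ‖M *ᵥ v i‖ with hm
  have hd0 : (0 : ℝ) < d := by exact_mod_cast hd
  have : Nonempty (Fin d) := ⟨⟨0, hd⟩⟩
  have hMinj : Function.Injective M.mulVec :=
    Matrix.mulVec_injective_of_isUnit ((Matrix.isUnit_iff_isUnit_det _).2
      (isUnit_iff_ne_zero.2 fun h => by simp [h] at hM))
  obtain ⟨Q, hQ, hQtri⟩ := exists_orthogonal_triangular fun i => M *ᵥ v i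
  have hQdet : |Q.det| = 1 := by
    have h := congrArg Matrix.det ((Matrix.mem_orthogonalGroup_iff _ _).1 hQ)
    rw [Matrix.det_mul, Matrix.det_one, Matrix.det_transpose] at h
    rcases mul_self_eq_one_iff.1 h with h | h <;> simp [h]
  have hQentry : ∀ i j, |Q i j| ≤ 1 := by
    intro i j
    have h := congrFun (congrFun ((Matrix.mem_orthogonalGroup_iff _ _).1 hQ) i) i
    simp only [Matrix.mul_apply, Matrix.transpose_apply, Matrix.one_apply_eq] at h
    have := Finset.single_le_sum (f := fun j => Q i j * Q i j) (fun j _ => mul_self_nonneg _)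
      (Finset.mem_univ j)
    rw [abs_le_one_iff_mul_self_le_one]
    linarith
  by_contra! hlt
  let f : (Fin d → ℝ) →ₗ[ℝ] (Fin d → ℝ) := Matrix.toLin' (Q * M)
  have hf : |LinearMap.det f| = 1 := by
    simp [f, LinearMap.det_toLin', abs_mul, hQdet, hM]
  -- If the product exceeded `d ^ d`, this box would exceed Minkowski's volume threshold `2 ^ d`.
  -- The divisor `d` pays for the `d` terms summed when `Qᵀ` is undone.
  let K : Set (Fin d → ℝ) := Set.univ.pi fun i => Set.Ioo (-(m i / d)) (m i / d)
  let b : Basis (Fin d) ℤ L := IsZLattice.basis L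
  have hμF : MeasureTheory.volume (ZSpan.fundamentalDomain (b.ofZLatticeBasis ℝ)) = 1 := by
    have h := ZLattice.covolume_eq_measure_fundamentalDomain L MeasureTheory.volume
      (ZLattice.isAddFundamentalDomain b MeasureTheory.volume)
    rw [hcov, MeasureTheory.measureReal_def, eq_comm] at h
    exact (ENNReal.toReal_eq_one_iff _).1 h
  have hvol : MeasureTheory.volume (f ⁻¹' K) = ENNReal.ofReal (2 ^ d * ((∏ i, m i) / d ^ d)) := by
    rw [MeasureTheory.Measure.addHaar_preimage_linearMap _ (fun h => by simp [h] at hf), abs_inv, hf,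
      Real.volume_pi_Ioo]
    rw [← ENNReal.ofReal_prod_of_nonneg fun i _ => by
      have : 0 ≤ m i / d := by positivity
      linarith]
    rw [inv_one, ENNReal.ofReal_one, one_mul]
    congr 1
    have : ∀ i, m i / d - -(m i / d) = 2 * (m i / d) := fun i => by ring
    simp [this, Finset.prod_mul_distrib, Finset.prod_div_distrib]
  have hgt : MeasureTheory.volume (ZSpan.fundamentalDomain (b.ofZLatticeBasis ℝ)) *
      2 ^ finrank ℝ (Fin d → ℝ) < MeasureTheory.volume (f ⁻¹' K) := by
    rw [hμF, hvol, one_mul, finrank_fin_fun, ← ENNReal.ofReal_ofNat 2,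
      ← ENNReal.ofReal_pow (by norm_num)]
    refine (ENNReal.ofReal_lt_ofReal_iff_of_nonneg (by positivity)).2 ?_
    exact lt_mul_of_one_lt_right (by positivity) ((one_lt_div (by positivity)).2 hlt)
  have : Countable L.toAddSubgroup := inferInstanceAs (Countable L)
  obtain ⟨⟨x, hxL⟩, hx0, hxK⟩ :=
    MeasureTheory.exists_ne_zero_mem_lattice_of_measure_mul_two_pow_lt_measure
      (L := L.toAddSubgroup) (ZLattice.isAddFundamentalDomain b MeasureTheory.volume)
      (s := f ⁻¹' K) (fun y hy i _ => by
        have := hy i trivial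
        simp only [map_neg, Pi.neg_apply, Set.mem_Ioo] at this ⊢
        constructor <;> linarith)
      ((convex_pi fun i _ => convex_Ioo _ _).linear_preimage f) hgt
  replace hxL : x ∈ L := hxL
  have hx0 : x ≠ 0 := by simpa using hx0
  have hspan : span ℝ (Set.range v) = ⊤ :=
    hv.linearIndependent.span_eq_top_of_card_eq_finrank (by simp)
  -- Triangularity kills the coordinates after `k`, and the others are below `m k / d`; so `M *ᵥ x`
  -- has norm below `m k`, against `hle`.
  obtain ⟨k, hxk, hle⟩ := hv.exists_mem_span_image_Iic hspan hxL hx0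
  have hzero : ∀ j, k < j → (Q *ᵥ (M *ᵥ x)) j = 0 := by
    intro j hkj
    have : span ℝ (v '' Set.Iic k) ≤ LinearMap.ker (LinearMap.proj j ∘ₗ f) := by
      rw [span_le]
      rintro _ ⟨i, hi, rfl⟩
      simpa [f, ← Matrix.mulVec_mulVec] using hQtri i j (lt_of_le_of_lt hi hkj)
    simpa [f, ← Matrix.mulVec_mulVec] using this hxk
  have hcoord : ∀ j, |(Q *ᵥ (M *ᵥ x)) j| < m k / d := by
    intro j
    have hj := hxK j trivial
    have hmpos : ∀ i, 0 < m i := fun i =>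
      norm_pos_iff.2 fun h => hv.linearIndependent.ne_zero i (hMinj (by simpa using h))
    rcases le_or_gt j k with hjk | hjk
    · have h1 : m j ≤ m k := hv.monotone hjk
      refine lt_of_lt_of_le (abs_lt.2 ?_) (div_le_div_of_nonneg_right h1 hd0.le)
      simpa [f, ← Matrix.mulVec_mulVec] using hj
    · rw [hzero j hjk, abs_zero]
      exact div_pos (hmpos k) hd0
  have hback : M *ᵥ x = Qᵀ *ᵥ (Q *ᵥ (M *ᵥ x)) := by
    have h := (Matrix.mem_orthogonalGroup_iff' _ _).1 hQ
    rw [Matrix.mulVec_mulVec, h, Matrix.one_mulVec]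
  refine absurd hle (not_le.2 ?_)
  have hk0 : 0 < m k := by
    have := (abs_nonneg _).trans_lt (hcoord k)
    exact (div_pos_iff_of_pos_right hd0).1 this
  refine (pi_norm_lt_iff hk0).2 fun i => ?_
  rw [hback, Real.norm_eq_abs]
  calc |∑ j, Q j i * (Q *ᵥ (M *ᵥ x)) j| ≤ ∑ j, |Q j i * (Q *ᵥ (M *ᵥ x)) j| :=
        Finset.abs_sum_le_sum_abs _ _
    _ < ∑ _j : Fin d, m k / d := by
      refine Finset.sum_lt_sum_of_nonempty Finset.univ_nonempty fun j _ => ?_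
      rw [abs_mul]
      exact (mul_le_of_le_one_left (abs_nonneg _) (hQentry j i)).trans_lt (hcoord j)
    _ = m k := by simp; field_simp

end Lattice

/-! ### Boxes as balls of a rescaled sup-norm. -/

lemma mem_smul_box_iff {d : ℕ} (τ : Fin d → ℝ) {r : ℝ} (hr : 0 < r) (x : Fin d → ℝ) :
    x ∈ r • box τ ↔ ‖diagExp (-τ) *ᵥ x‖ ≤ r := by
  rw [pi_norm_le_iff_of_nonneg hr.le]
  simp only [diagExp, Matrix.mulVec_diagonal, Pi.neg_apply, Real.norm_eq_abs, box, cube,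
    Set.mem_smul_set, Set.mem_image, Set.mem_ofPred_eq]
  constructor
  · rintro ⟨_, ⟨y, hy, rfl⟩, rfl⟩ i
    have : Real.exp (-τ i) * (r * (Real.exp (τ i) * y i)) = r * y i := by
      rw [Real.exp_neg]
      field_simp
    simpa [Matrix.mulVec_diagonal, this, abs_mul, abs_of_pos hr, hr] using hy i
  · intro h
    refine ⟨r⁻¹ • x, ⟨fun i => r⁻¹ * (Real.exp (-τ i) * x i), fun i => ?_, ?_⟩, ?_⟩
    · rw [abs_mul, abs_inv, abs_of_pos hr, inv_mul_le_iff₀ hr, mul_one]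
      exact h i
    · ext i
      rw [Matrix.mulVec_diagonal, Real.exp_neg]
      simp only [Pi.smul_apply, smul_eq_mul]
      field_simp
    · rw [smul_inv_smul₀ hr.ne']

lemma det_diagExp {d : ℕ} {τ : Fin d → ℝ} (hτ : ∑ i, τ i = 0) : (diagExp τ).det = 1 := by
  rw [diagExp, Matrix.det_diagonal, ← Real.exp_sum, hτ, Real.exp_zero]

/-- Gives positivity of the rescaled norm and finiteness of lattice points in its balls. -/
lemma norm_le_mul_norm_diagExp_neg_mulVec {d : ℕ} (τ : Fin d → ℝ) (x : Fin d → ℝ) :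
    ‖x‖ ≤ Real.exp ‖τ‖ * ‖diagExp (-τ) *ᵥ x‖ := by
  refine (pi_norm_le_iff_of_nonneg (by positivity)).2 fun i => ?_
  have h1 : x i = Real.exp (τ i) * (diagExp (-τ) *ᵥ x) i := by
    rw [diagExp, Matrix.mulVec_diagonal, Pi.neg_apply, Real.exp_neg]
    field_simp
  rw [h1, norm_mul, Real.norm_of_nonneg (Real.exp_nonneg _)]
  gcongr
  · exact (le_abs_self _).trans (norm_le_pi_norm τ i)
  · exact norm_le_pi_norm _ i

/-- Minkowski's second theorem for the parallelepipeds `box τ`, in logarithmic form and with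
non-optimal constants. -/
lemma exists_abs_sum_log_successiveMin_le {d : ℕ} (hd : 1 ≤ d) (L : Submodule ℤ (Fin d → ℝ))
    [DiscreteTopology L] [IsZLattice ℝ L]
    (hL : ZLattice.covolume L MeasureTheory.volume = 1) :
    ∃ C : ℝ, ∀ τ : Fin d → ℝ, ∑ i, τ i = 0 →
      |∑ p ∈ Finset.Icc 1 d, Real.log (successiveMin L (box τ) p)| ≤ C := by
  -- The two constants come from the lower and upper product bounds; neither involves `τ`.
  refine ⟨max (Real.log d.factorial) (Real.log ((d : ℝ) ^ d)), fun τ hτ => ?_⟩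
  set M := diagExp (-τ) with hMdef
  have hM : |M.det| = 1 := by rw [hMdef, det_diagExp (by simp [hτ]), abs_one]
  have hpos : ∀ x, x ≠ 0 → 0 < ‖M *ᵥ x‖ := fun x hx =>
    pos_of_mul_pos_right ((norm_pos_iff.2 hx).trans_le
      (norm_le_mul_norm_diagExp_neg_mulVec τ x)) (Real.exp_nonneg _)
  have hfin : ∀ R : ℝ, {x | x ∈ L ∧ ‖M *ᵥ x‖ ≤ R}.Finite := by
    intro R
    refine (Metric.finite_isBounded_inter_isClosed (s := (L : Set (Fin d → ℝ)))
      DiscreteTopology.isDiscrete (Metric.isBounded_closedBall (x := 0) (r := Real.exp ‖τ‖ * R))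
      ?_).subset ?_
    · exact AddSubgroup.isClosed_of_discrete (H := L.toAddSubgroup)
    · rintro x ⟨hx, hxR⟩
      refine ⟨mem_closedBall_zero_iff.2 ((norm_le_mul_norm_diagExp_neg_mulVec τ x).trans ?_), hx⟩
      gcongr
  obtain ⟨v, hv⟩ := exists_isGreedy (n := d) IsZLattice.span_top hfin (by simp)
  have hmin : ∀ k : Fin d, successiveMin L (box τ) (k + 1) = ‖M *ᵥ v k‖ := by
    intro k
    rw [← (hv.isLeast hpos k).csInf_eq, successiveMin]
    congr 1
    ext r
    refine and_congr_right fun hr => ?_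
    simp only [mem_smul_box_iff τ hr, hMdef]
  have hvpos : ∀ k, 0 < ‖M *ᵥ v k‖ := fun k => hpos _ (hv.linearIndependent.ne_zero k)
  have hsum : ∑ p ∈ Finset.Icc 1 d, Real.log (successiveMin L (box τ) p) =
      Real.log (∏ k, ‖M *ᵥ v k‖) := by
    rw [Real.log_prod fun k _ => (hvpos k).ne', ← Finset.sum_congr rfl fun k _ =>
      congrArg Real.log (hmin k), Fin.sum_univ_eq_sum_range
      (fun k => Real.log (successiveMin L (box τ) (k + 1))) d, Finset.range_eq_Ico,
      Finset.sum_Ico_add' (fun k => Real.log (successiveMin L (box τ) k)) 0 d 1]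
    rfl
  have hprod : 0 < ∏ k, ‖M *ᵥ v k‖ := Finset.prod_pos fun k _ => hvpos k
  have hlower := Real.log_le_log one_pos (one_le_factorial_mul_prod L hL hM
    hv.linearIndependent hv.mem)
  rw [Real.log_one, Real.log_mul (by positivity) hprod.ne'] at hlower
  have hupper := Real.log_le_log hprod (prod_le_pow L hd hL hM hv)
  rw [hsum, abs_le]
  constructor
  · linarith [le_max_left (Real.log d.factorial) (Real.log ((d : ℝ) ^ d))]
  · exact hupper.trans (le_max_right _ _)

/-! ### Passage to the limit in the extended reals. -/

/-- Superadditivity of liminf for `f = g + (f - g)`; the second summand contributes 0, which is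
harmless even at infinite values. -/
lemma liminf_coe_le_of_tendsto_sub {f g : ℝ → ℝ}
    (h : Tendsto (fun s => f s - g s) atTop (𝓝 0)) :
    liminf (fun s => (g s : EReal)) atTop ≤ liminf (fun s => (f s : EReal)) atTop := by
  have h1 : Tendsto (fun s => ((f s - g s : ℝ) : EReal)) atTop (𝓝 0) :=
    (continuous_coe_real_ereal.tendsto 0).comp h
  have h2 := EReal.le_liminf_add (u := fun s => (g s : EReal))
    (v := fun s => ((f s - g s : ℝ) : EReal)) (f := atTop)
  rw [h1.liminf_eq, add_zero] at h2
  refine h2.trans_eq (congrArg (liminf · atTop) (funext fun s => ?_))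
  simp only [Pi.add_apply]
  rw [← EReal.coe_add, add_sub_cancel]

lemma liminf_coe_eq_neg_limsup_of_tendsto_add {f g : ℝ → ℝ}
    (h : Tendsto (fun s => f s + g s) atTop (𝓝 0)) :
    liminf (fun s => (f s : EReal)) atTop = -limsup (fun s => (g s : EReal)) atTop := by
  rw [← EReal.liminf_neg]
  have hneg : (-fun s => (g s : EReal)) = fun s => ((-g s : ℝ) : EReal) := by
    ext s
    simp
  rw [hneg]
  refine le_antisymm (liminf_coe_le_of_tendsto_sub ?_) (liminf_coe_le_of_tendsto_sub ?_)
  · simpa [sub_eq_add_neg, add_comm] using h.neg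
  · simpa using h

lemma tendsto_sum_psi {d : ℕ} (hd : 1 ≤ d) (L : Submodule ℤ (Fin d → ℝ))
    [DiscreteTopology L] [IsZLattice ℝ L]
    (hL : ZLattice.covolume L MeasureTheory.volume = 1)
    (τ : ℝ → Fin d → ℝ) (hτ : ∀ s : ℝ, 0 < s → ∑ i, τ s i = 0) :
    Tendsto (fun s => ∑ p ∈ Finset.Icc 1 d, psi L τ p s) atTop (𝓝 0) := by
  obtain ⟨C, hC⟩ := exists_abs_sum_log_successiveMin_le hd L hL
  refine squeeze_zero_norm' ?_ (tendsto_const_nhds (x := C).div_atTop tendsto_id)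
  filter_upwards [eventually_gt_atTop 0] with s hs
  simp only [psi, ← Finset.sum_div, norm_div, Real.norm_eq_abs, abs_of_pos hs, id]
  gcongr
  exact hC _ (hτ s hs)

end SchmidtExponents

end

theorem mainTheorem7 (d : ℕ) (hd : 1 ≤ d)
    (L : Submodule ℤ (Fin d → ℝ)) [DiscreteTopology L] [IsZLattice ℝ L]
    (hL : ZLattice.covolume L MeasureTheory.volume = 1)
    (τ : ℝ → Fin d → ℝ) (hτ : ∀ s : ℝ, 0 < s → ∑ i, τ s i = 0) :
    SchmidtExponents.lowerPsi₂ L τ (d - 1) = -SchmidtExponents.upperPsi₁ L τ d ∧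
      SchmidtExponents.upperPsi₂ L τ (d - 1) = -SchmidtExponents.lowerPsi₁ L τ d := by
  have h := SchmidtExponents.tendsto_sum_psi hd L hL τ hτ
  obtain ⟨n, rfl⟩ := Nat.exists_eq_add_of_le' hd
  simp only [Finset.sum_Icc_succ_top (Nat.le_add_left 1 n)] at h
  refine ⟨SchmidtExponents.liminf_coe_eq_neg_limsup_of_tendsto_add h, ?_⟩
  -- The second identity is the first with the two summands exchanged.
  rw [SchmidtExponents.lowerPsi₁, SchmidtExponents.liminf_coe_eq_neg_limsup_of_tendsto_add
    (h.congr fun s => add_comm _ _), neg_neg]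
  rfl
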